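/- Let $V$ be a finite set with $d=|V|\ge 2$ elements, let $\mathcal I_v$ ($v\in V$) be finite sets, and let $\mathcal I=\prod_{v\in V}\mathcal I_v$. Let $\mathbf p=(\mathbf p(\underline i))_{\underline i\in\mathcal I}$ be a vector of random cell probabilities, i.e. a random vector with $\mathbf p(\underline i)>0$ for all $\underline i$ and $\sum_{\underline i\in\mathcal I}\mathbf p(\underline i)=1$ almost surely. For $D\subset V$, $v\in V$, $m\in\mathcal I_v$ and $\underline k\in\mathcal I_D=\prod_{u\in D}\mathcal I_u$ put $$\mathbb P_{\mathbf p}(X_v=m\mid X_D=\underline k)=\frac{\sum_{\underline i:\ \underline i_D=\underline k,\ i_v=m}\mathbf p(\underline i)}{\sum_{\underline i:\ \underline i_D=\underline k}\mathbf p(\underline i)} .$$ A directed acyclic graph (DAG) on $V$ is described by its parent function $\mathfrak p$, where $\mathfrak p_v\subset V$ is the set of parents of $v$. A DAG whose skeleton is the complete graph on $V$ has a unique numbering $v_1,\dots,v_d$ of $V$ with $\mathfrak p_{v_1}=\emptyset$ and $\mathfrak p_{v_j}=\mathfrak p_{v_{j-1}}\cup\{v_{j-1}\}$ for $j=2,\dots,d$.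 Parameter independence for $\mathbf p$ with respect to $\mathfrak p$ means that the random vectors $$\bigl(\mathbb P_{\mathbf p}(X_v=m\mid X_{\mathfrak p_v}=\underline k)\bigr)_{m\in\mathcal I_v},\qquad \underline k\in\mathcal I_{\mathfrak p_v},\ v\in V,$$ are mutually independent and that each of them is non-degenerate (not almost surely constant). Let $\mathfrak p$ and $\mathfrak p'$ be the parent functions of two DAGs whose skeleton is the complete graph on $V$, with the corresponding numberings $v_1,\dots,v_d$ and $v'_1,\dots,v'_d$, and suppose that $$\mathfrak p_{v_j}\neq\mathfrak p'_{v'_j}\qquad\text{for all } j=2,\dots,d .$$ If parameter independence holds for $\mathbf p$ with respect to $\mathfrak p$ and with respect to $\mathfrak p'$, then $\mathbf p$ has a classical Dirichlet distribution: there are $\alpha_{\underline i}>0$ ($\underline i\in\mathcal I$) such that, for any choice of a cell $\underline i_0$, the coordinates $(\mathbf p(\underline i))_{\underline i\ne\underline i_0}$ have the density $$\frac{\Gamma\bigl(\sum_{\underline i\in\mathcal I}\alpha_{\underline i}\bigr)}{\prod_{\underline i\in\mathcal I}\Gamma(\alpha_{\underline i})}\prod_{\underline i\in\mathcal I}x_{\underline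 i}^{\alpha_{\underline i}-1},\qquad x_{\underline i_0}=1-\sum_{\underline i\ne\underline i_0}x_{\underline i},$$ with respect to Lebesgue measure on $\{x\in(0,1)^{\mathcal I\setminus\{\underline i_0\}}:\ \sum_{\underline i\neq\underline i_0}x_{\underline i}<1\}$, and $\mathbf p(\underline i_0)=1-\sum_{\underline i\ne\underline i_0}\mathbf p(\underline i)$ almost surely. No density of $\mathbf p$ is assumed. -/

import Mathlib

open MeasureTheory ProbabilityTheory

/-! ### DAGs given by their parent functions -/

section DAG

variable {V : Type*}

/-- The undirected skeleton of the directed graph with parent function `𝔭`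
(there is an arrow `u → v` iff `u ∈ 𝔭 v`). -/
def dagSkeleton (𝔭 : V → Finset V) : SimpleGraph V :=
  SimpleGraph.fromRel (fun u v => u ∈ 𝔭 v)

/-- `𝔭` is the parent function of a directed acyclic graph. -/
def IsAcyclicParentFunction (𝔭 : V → Finset V) : Prop :=
  ∀ v, ¬ Relation.TransGen (fun u w => u ∈ 𝔭 w) v v

/-- `𝔭` is moral: distinct parents of a common child are joined by an edge of the skeleton. -/
def IsMoralParentFunction (𝔭 : V → Finset V) : Prop :=
  ∀ w u u', u ∈ 𝔭 w → u' ∈ 𝔭 w → u ≠ u' → (dagSkeleton 𝔭).Adj u u'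

/-- `𝔭` is the parent function of a moral DAG with skeleton `G`. -/
structure IsMoralDAG (G : SimpleGraph V) (𝔭 : V → Finset V) : Prop where
  acyclic : IsAcyclicParentFunction 𝔭
  skeleton : dagSkeleton 𝔭 = G
  moral : IsMoralParentFunction 𝔭

/-- `v₁, …, v_d` (here `v 0, …, v (d - 1)`) is the numbering of the vertices of a DAG on the
complete graph: `𝔭_{v₁} = ∅` and `𝔭_{v_j} = 𝔭_{v_{j-1}} ∪ {v_{j-1}}` for `j ≥ 2`. -/
structure IsVertexNumbering [DecidableEq V] {d : ℕ} (𝔭 : V → Finset V) (v : Fin d ≃ V) :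
    Prop where
  first : ∀ j : Fin d, j.val = 0 → 𝔭 (v j) = ∅
  next : ∀ j k : Fin d, k.val = j.val + 1 → 𝔭 (v k) = insert (v j) (𝔭 (v j))

end DAG

/-! ### Cell probabilities and parameter independence -/

section Cells

variable {V : Type*} {I : V → Type*} [Fintype V] [DecidableEq V]
  [∀ v, Fintype (I v)] [∀ v, DecidableEq (I v)]

/-- `ℙ_p(X_D = k)`, the probability of the `D`-marginal cell `k` under the cell
probabilities `p`. -/
def marginalProb (p : (∀ v, I v) → ℝ) (D : Finset V) (k : ∀ u : D, I u) : ℝ :=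
  ∑ i with D.restrict i = k, p i

/-- `ℙ_p(X_v = m | X_D = k) = ℙ_p(X_D = k, X_v = m) / ℙ_p(X_D = k)`. -/
noncomputable def condCellProb (p : (∀ v, I v) → ℝ) (v : V) (D : Finset V)
    (k : ∀ u : D, I u) (m : I v) : ℝ :=
  (∑ i with D.restrict i = k ∧ i v = m, p i) / marginalProb p D k

variable {Ω : Type*} [MeasurableSpace Ω]

/-- A vector of random cell probabilities: a random vector indexed by the cells whose
coordinates are (almost surely) positive and sum to one. -/
structure IsRandomCellProb (P : Measure Ω) (p : Ω → (∀ v, I v) → ℝ) : Prop where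
  measurable : Measurable p
  pos : ∀ᵐ ω ∂P, ∀ i, 0 < p ω i
  sum_eq_one : ∀ᵐ ω ∂P, ∑ i, p ω i = 1

/-- The random vector `(ℙ_𝐩(X_v = m | X_{𝔭_v} = k), m ∈ I_v)`, where `s = ⟨v, k⟩` runs over
the vertices `v` together with a configuration `k` of the parents of `v`. -/
noncomputable def dagParameter (p : Ω → (∀ v, I v) → ℝ) (𝔭 : V → Finset V)
    (s : (v : V) × (∀ u : 𝔭 v, I u)) (ω : Ω) : I s.1 → ℝ :=
  fun m => condCellProb (p ω) s.1 (𝔭 s.1) s.2 m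

/-- Parameter independence (local and global) with respect to the DAG with parent function `𝔭`:
the random vectors `(ℙ_𝐩(X_v = m | X_{𝔭_v} = k), m ∈ I_v)`, over all `v` and all `k`,
are mutually independent, and none of them is almost surely constant. -/
structure ParameterIndependence (P : Measure Ω) (p : Ω → (∀ v, I v) → ℝ) (𝔭 : V → Finset V) :
    Prop where
  indep : iIndepFun (dagParameter p 𝔭) P
  nondegenerate : ∀ s : (v : V) × (∀ u : 𝔭 v, I u),
    ¬ ∃ c : I s.1 → ℝ, ∀ᵐ ω ∂P, dagParameter p 𝔭 s ω = c

end Cells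

/-! ### The classical Dirichlet distribution -/

section Dirichlet

variable {ι : Type*} [Fintype ι] [DecidableEq ι]

/-- Complete the free coordinates `x i`, `i ≠ i₀`, by `x i₀ = 1 - ∑ x i`. -/
def simplexCompletion (i₀ : ι) (x : {i : ι // i ≠ i₀} → ℝ) : ι → ℝ :=
  fun i => if h : i = i₀ then 1 - ∑ j, x j else x ⟨i, h⟩

theorem measurable_simplexCompletion (i₀ : ι) : Measurable (simplexCompletion i₀) := by
  refine measurable_pi_lambda _ fun i => ?_
  unfold simplexCompletion
  by_cases h : i = i₀ <;> simp only [h, dite_true, dite_false] <;> fun_prop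

/-- The open simplex of free coordinates. -/
def openSimplex (i₀ : ι) : Set ({i : ι // i ≠ i₀} → ℝ) :=
  {x | (∀ j, x j ∈ Set.Ioo (0 : ℝ) 1) ∧ ∑ j, x j < 1}

/-- The Dirichlet density with parameters `α`, in the free coordinates `x i`, `i ≠ i₀`. -/
noncomputable def dirichletDensity (α : ι → ℝ) (i₀ : ι) (x : {i : ι // i ≠ i₀} → ℝ) : ℝ :=
  (openSimplex i₀).indicator
    (fun x => Real.Gamma (∑ i, α i) / (∏ i, Real.Gamma (α i)) *
      ∏ i, simplexCompletion i₀ x i ^ (α i - 1)) x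

/-- The Dirichlet law on `ι → ℝ`: the free coordinates have the Dirichlet density with respect
to Lebesgue measure, and the coordinate `i₀` is one minus their sum. -/
noncomputable def dirichletMeasure (α : ι → ℝ) (i₀ : ι) : Measure (ι → ℝ) :=
  (volume.withDensity fun x => ENNReal.ofReal (dirichletDensity α i₀ x)).map
    (simplexCompletion i₀)

/-- `μ` is a classical Dirichlet distribution with positive parameters; the description by a
density holds whichever coordinate is eliminated. -/
def IsClassicalDirichlet (μ : Measure (ι → ℝ)) : Prop :=
  Nonempty ι ∧ ∃ α : ι → ℝ, (∀ i, 0 < α i) ∧ ∀ i₀, μ = dirichletMeasure α i₀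

end Dirichlet

/-! Everything is read off the mixed moments M(n) = E ∏ p(x)^n(x), indexed by contingency tables n;
no density is needed because moments determine a law on the cube.

Under parameter independence for one complete DAG, the chain rule factors M, so log M is a sum of
functions of the family counts. Take the second mixed difference of log M in the directions of two
cells that differ at w. Terms whose parent set contains w cancel, since the two cells fall into
different parent configurations; every other family lies inside the family of w. The difference
therefore sees only the marginals on that family (`mixedDiffLocal_of_eq_sum`).

With two DAGs, coordinates outside one family may be altered freely and the other DAG then applied.
The roots differ, so differences at a root depend only on the total |n| (`mixedDiff_eq_of_roots`).
Since the parent sets differ at every later position, this propagates by induction to every pair of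
distinct cells (`exists_mixedDiff_eq`).

Hence M(n+i+j) M(n) = ρ(|n|) M(n+i) M(n+j) for i ≠ j. Together with ∑ M(n+i) = M(n) this forces the
predictive probabilities M(n+i)/M(n) to be (α_i + n_i)/(∑ α + |n|), as in a Pólya urn
(`predictive_of_mixed`); non-degeneracy excludes the constant case. These are the Dirichlet moments,
and `ext_of_lintegral_moments` finishes. -/

section Combinatorics

/-! ### Mixed differences of a function of tables that is local for two DAGs -/

/-- The second mixed difference of `L` in the directions of the cells `i` and `j`. -/
def mixedDiff {ι E : Type*} [DecidableEq ι] [AddCommGroup E] (L : (ι → ℕ) → E) (i j : ι)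
    (n : ι → ℕ) : E :=
  L (n + Pi.single i 1 + Pi.single j 1) - L (n + Pi.single i 1) - L (n + Pi.single j 1) + L n

section Numbering

variable {V : Type*} [DecidableEq V]

theorem IsVertexNumbering.mem_iff {d : ℕ} {𝔭 : V → Finset V} {v : Fin d ≃ V}
    (hv : IsVertexNumbering 𝔭 v) (s t : Fin d) : v s ∈ 𝔭 (v t) ↔ s < t := by
  obtain ⟨t, ht⟩ := t
  induction t with
  | zero => simp [hv.first ⟨0, ht⟩ rfl, Fin.lt_def]
  | succ t ih =>
    rw [hv.next ⟨t, by omega⟩ ⟨t + 1, ht⟩ rfl, Finset.mem_insert, ih (by omega),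
      v.injective.eq_iff, Fin.lt_def, Fin.lt_def, Fin.ext_iff]
    simp only
    omega

theorem IsVertexNumbering.eq_map {d : ℕ} {𝔭 : V → Finset V} {v : Fin d ≃ V}
    (hv : IsVertexNumbering 𝔭 v) (t : Fin d) : 𝔭 (v t) = (Finset.Iio t).map v.toEmbedding := by
  ext x
  obtain ⟨s, rfl⟩ := v.surjective x
  simp [hv.mem_iff]

/-- Families are initial segments of the numbering, so either w comes strictly before w' or the
family of w' is contained in that of w. This is the dichotomy behind the cancellation in
`mixedDiffLocal_of_eq_sum`. -/
theorem IsVertexNumbering.subset_or_mem {d : ℕ} {𝔭 : V → Finset V} {v : Fin d ≃ V}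
    (hv : IsVertexNumbering 𝔭 v) (w w' : V) :
    insert w' (𝔭 w') ⊆ insert w (𝔭 w) ∨ w ∈ 𝔭 w' := by
  obtain ⟨s, rfl⟩ := v.surjective w
  obtain ⟨t, rfl⟩ := v.surjective w'
  rw [hv.mem_iff]
  rcases lt_or_ge s t with h | h
  · exact Or.inr h
  · left
    intro x hx
    obtain ⟨r, rfl⟩ := v.surjective x
    simp only [Finset.mem_insert, hv.mem_iff, v.injective.eq_iff] at hx ⊢
    omega

end Numbering

variable {V : Type*} {I : V → Type*} [Fintype V] [DecidableEq V]
  [∀ v, Fintype (I v)]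

/-- Two contingency tables have the same `D`-marginal, expressed by testing against functions
of the coordinates in `D`. -/
def SameMarginal (D : Finset V) (n n' : (∀ v, I v) → ℕ) : Prop :=
  ∀ f : (∀ v, I v) → ℕ, (∀ x y, (∀ u ∈ D, x u = y u) → f x = f y) →
    ∑ x, f x * n x = ∑ x, f x * n' x

theorem SameMarginal.refl (D : Finset V) (n : (∀ v, I v) → ℕ) : SameMarginal D n n :=
  fun _ _ => rfl

variable [∀ v, DecidableEq (I v)]

/-- If `i` and `i'` differ at `w`, then `mixedDiff L i i' n` only depends on the marginals of
`i`, `i'` and `n` on the family `insert w (𝔭 w)`. -/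
def MixedDiffLocal (𝔭 : V → Finset V) (L : ((∀ v, I v) → ℕ) → ℝ) : Prop :=
  ∀ w (i i' j j' : ∀ v, I v) n n', i w ≠ i' w → (∀ u ∈ insert w (𝔭 w), i u = j u) →
    (∀ u ∈ insert w (𝔭 w), i' u = j' u) → SameMarginal (insert w (𝔭 w)) n n' →
    mixedDiff L i i' n = mixedDiff L j j' n'

/-- The number of observations in the table `n` in a cell with parent configuration `s.2` and
value `m` at the vertex `s.1`. -/
def familyCount (𝔭 : V → Finset V) (s : (v : V) × (∀ u : 𝔭 v, I u))
    (n : (∀ v, I v) → ℕ) (m : I s.1) : ℕ :=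
  ∑ x, (if (𝔭 s.1).restrict x = s.2 ∧ x s.1 = m then 1 else 0) * n x

theorem familyCount_add (𝔭 : V → Finset V) (s : (v : V) × (∀ u : 𝔭 v, I u))
    (n n' : (∀ v, I v) → ℕ) :
    familyCount 𝔭 s (n + n') = familyCount 𝔭 s n + familyCount 𝔭 s n' := by
  ext m
  simp only [familyCount, Pi.add_apply, mul_add, Finset.sum_add_distrib]

theorem familyCount_single (𝔭 : V → Finset V) (s : (v : V) × (∀ u : 𝔭 v, I u))
    (i : ∀ v, I v) (m : I s.1) : familyCount 𝔭 s (Pi.single i 1) m =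
      if (𝔭 s.1).restrict i = s.2 ∧ i s.1 = m then 1 else 0 := by
  simp [familyCount, Pi.single_apply]

/-- Treat each summand separately. If its family lies in that of w, its arguments are determined by
the marginals on the family of w. If w is one of its parents, at most one of the two added
observations changes its count, and its mixed difference is zero. -/
theorem mixedDiffLocal_of_eq_sum {d : ℕ} {𝔭 : V → Finset V} {v : Fin d ≃ V}
    (hv : IsVertexNumbering 𝔭 v) {L : ((∀ v, I v) → ℕ) → ℝ}
    (g : (s : (v : V) × (∀ u : 𝔭 v, I u)) → (I s.1 → ℕ) → ℝ)
    (hL : ∀ n, L n = ∑ s, g s (familyCount 𝔭 s n)) : MixedDiffLocal 𝔭 L := by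
  intro w i i' j j' n n' hw hi hi' hn
  simp only [mixedDiff, hL, ← Finset.sum_sub_distrib, ← Finset.sum_add_distrib]
  refine Finset.sum_congr rfl fun s _ => ?_
  simp only [familyCount_add]
  rcases hv.subset_or_mem w s.1 with h | h
  · have key : ∀ x y : ∀ v, I v, (∀ u ∈ insert w (𝔭 w), x u = y u) → ∀ m,
        ((𝔭 s.1).restrict x = s.2 ∧ x s.1 = m ↔ (𝔭 s.1).restrict y = s.2 ∧ y s.1 = m) := by
      intro x y hxy m
      have h1 : (𝔭 s.1).restrict x = (𝔭 s.1).restrict y := by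
        ext u
        exact hxy _ (h (Finset.mem_insert_of_mem u.2))
      rw [h1, hxy _ (h (Finset.mem_insert_self _ _))]
    have e : ∀ x y : ∀ v, I v, (∀ u ∈ insert w (𝔭 w), x u = y u) →
        familyCount 𝔭 s (Pi.single x 1) = familyCount 𝔭 s (Pi.single y 1) := by
      intro x y hxy
      ext m
      simp only [familyCount_single, key x y hxy m]
    have en : familyCount 𝔭 s n = familyCount 𝔭 s n' := by
      ext m
      refine hn _ fun x y hxy => ?_
      simp only [key x y hxy m]
    rw [e i j hi, e i' j' hi', en]
  · have key : ∀ x y : ∀ v, I v, x w ≠ y w →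
        familyCount 𝔭 s (Pi.single x 1) = 0 ∨ familyCount 𝔭 s (Pi.single y 1) = 0 := by
      intro x y hxy
      by_cases hx : (𝔭 s.1).restrict x = s.2
      · right
        ext m
        have : ¬ (𝔭 s.1).restrict y = s.2 := by
          rw [← hx]
          intro hyx
          exact hxy (congrFun hyx ⟨w, h⟩).symm
        simp [familyCount_single, this]
      · left
        ext m
        simp [familyCount_single, hx]
    have zero : ∀ (c : I s.1 → ℕ) (x y : ∀ v, I v), x w ≠ y w →
        g s (c + familyCount 𝔭 s (Pi.single x 1) + familyCount 𝔭 s (Pi.single y 1)) -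
          g s (c + familyCount 𝔭 s (Pi.single x 1)) -
          g s (c + familyCount 𝔭 s (Pi.single y 1)) + g s c = 0 := by
      intro c x y hxy
      rcases key x y hxy with h0 | h0 <;> simp [h0]
    rw [zero _ i i' hw, zero _ j j' (by
      rw [← hi w (Finset.mem_insert_self _ _), ← hi' w (Finset.mem_insert_self _ _)]; exact hw)]

theorem MixedDiffLocal.step {𝔭 : V → Finset V} {L : ((∀ v, I v) → ℕ) → ℝ}
    (hL : MixedDiffLocal 𝔭 L) {w x : V} (hx : x ∉ insert w (𝔭 w)) {i i' : ∀ v, I v}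
    (hw : i w ≠ i' w) (m : I x) (n : (∀ v, I v) → ℕ) :
    mixedDiff L i i' n = mixedDiff L i (Function.update i' x m) n := by
  refine hL w i i' _ _ n n hw (fun _ _ => rfl) (fun u hu => ?_) (SameMarginal.refl _ _)
  rw [Function.update_of_ne]
  rintro rfl
  exact hx hu

/-- The table of the observations `T x`, where `x` runs over the observations of `n`. -/
def pushTable (T : (∀ v, I v) → (∀ v, I v)) (n : (∀ v, I v) → ℕ) : (∀ v, I v) → ℕ :=
  fun y => ∑ x, if T x = y then n x else 0

theorem sum_mul_pushTable (T : (∀ v, I v) → (∀ v, I v)) (n f : (∀ v, I v) → ℕ) :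
    ∑ y, f y * pushTable T n y = ∑ x, f (T x) * n x := by
  simp only [pushTable, Finset.mul_sum]
  rw [Finset.sum_comm]
  simp

/-- The family of a root is the root alone. A difference at a ignores the coordinate b, and
conversely; alternating the two moves any pair to a reference pair r, r' differing at every vertex,
and any table to |n| copies of r. -/
theorem mixedDiff_eq_of_roots [∀ v, Nontrivial (I v)] {𝔭 𝔭' : V → Finset V}
    {L : ((∀ v, I v) → ℕ) → ℝ} (hL : MixedDiffLocal 𝔭 L) (hL' : MixedDiffLocal 𝔭' L)
    {a b : V} (hab : a ≠ b) (ha : 𝔭 a = ∅) (hb : 𝔭' b = ∅) :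
    ∃ φ : ℕ → ℝ, ∀ (i i' : ∀ v, I v) n, (i a ≠ i' a ∨ i b ≠ i' b) →
      mixedDiff L i i' n = φ (∑ x, n x) := by
  choose r r' hr using fun v => exists_pair_ne (I v)
  have hA : ∀ {i i' j j' : ∀ v, I v} {n n'}, i a ≠ i' a → i a = j a → i' a = j' a →
      SameMarginal {a} n n' → mixedDiff L i i' n = mixedDiff L j j' n' := by
    intro i i' j j' n n' h1 h2 h3 h4
    exact hL a i i' j j' n n' h1 (by simpa [ha] using h2) (by simpa [ha] using h3)
      (by simpa [ha] using h4)
  have hB : ∀ {i i' j j' : ∀ v, I v} {n n'}, i b ≠ i' b → i b = j b → i' b = j' b →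
      SameMarginal {b} n n' → mixedDiff L i i' n = mixedDiff L j j' n' := by
    intro i i' j j' n n' h1 h2 h3 h4
    exact hL' b i i' j j' n n' h1 (by simpa [hb] using h2) (by simpa [hb] using h3)
      (by simpa [hb] using h4)
  have ref : ∀ n, mixedDiff L r r' n = 
      mixedDiff L r r' (fun x => (∑ y, n y) * (Pi.single r 1 : (∀ v, I v) → ℕ) x) := by
    intro n
    -- Resetting the coordinate b of every observation to `r b` keeps the marginal at a; the new
    -- table then has the same marginal at b as |n| copies of r.
    trans mixedDiff L r r' (pushTable (fun x => Function.update x b (r b)) n)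
    · refine hA (hr a) rfl rfl fun f hf => ?_
      rw [sum_mul_pushTable]
      refine Finset.sum_congr rfl fun x _ => ?_
      rw [hf x]
      simp [hab]
    · refine hB (hr b) rfl rfl fun f hf => ?_
      rw [sum_mul_pushTable]
      have h1 : ∀ x, f (Function.update x b (r b)) = f r := fun x => hf _ _ (by simp)
      simp [h1, Pi.single_apply, ← Finset.mul_sum]
  refine ⟨fun N => mixedDiff L r r' (fun x => N * (Pi.single r 1 : (∀ v, I v) → ℕ) x),
    fun i i' n h => ?_⟩
  change _ = mixedDiff L r r' fun x => (∑ y, n y) * (Pi.single r 1 : (∀ v, I v) → ℕ) x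
  rw [← ref]
  rcases h with h | h
  · trans mixedDiff L (Function.update i b (r b)) (Function.update i' b (r' b)) n
    · exact hA h (by simp [hab]) (by simp [hab]) (SameMarginal.refl _ _)
    · exact hB (by simpa using hr b) (by simp) (by simp) (SameMarginal.refl _ _)
  · trans mixedDiff L (Function.update i a (r a)) (Function.update i' a (r' a)) n
    · exact hB h (by simp [hab.symm]) (by simp [hab.symm]) (SameMarginal.refl _ _)
    · exact hA (by simpa using hr a) (by simp) (by simp) (SameMarginal.refl _ _)

/-- Some vertex x precedes position t in the second numbering but is not a parent of v_t in the
first. The first DAG allows i' to be changed at x without affecting the difference, so the cells may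
be assumed to differ at x, where the earlier positions apply. -/
theorem mixedDiff_succ_of_local [∀ v, Nontrivial (I v)] {d : ℕ} {𝔭 𝔭' : V → Finset V}
    {v v' : Fin d ≃ V} (hv : IsVertexNumbering 𝔭 v) (hv' : IsVertexNumbering 𝔭' v')
    {L : ((∀ v, I v) → ℕ) → ℝ} (hL : MixedDiffLocal 𝔭 L) {φ : ℕ → ℝ} (t : Fin d)
    (hne : 𝔭 (v t) ≠ 𝔭' (v' t))
    (ih : ∀ (i i' : ∀ v, I v) n, (∃ s < t, i (v' s) ≠ i' (v' s)) →
      mixedDiff L i i' n = φ (∑ x, n x))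
    (i i' : ∀ v, I v) (n) (hi : i (v t) ≠ i' (v t)) :
    mixedDiff L i i' n = φ (∑ x, n x) := by
  obtain ⟨x, hx', hx⟩ : ∃ x ∈ 𝔭' (v' t), x ∉ 𝔭 (v t) := by
    -- Both parent sets have t elements, so an inclusion would be an equality.
    by_contra! h
    exact hne (Finset.eq_of_subset_of_card_le h (by simp [hv.eq_map, hv'.eq_map])).symm
  obtain ⟨s, rfl⟩ := v'.surjective x
  rw [hv'.mem_iff] at hx'
  by_cases hix : i (v' s) = i' (v' s)
  · have hxt : v' s ≠ v t := by
      intro h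
      rw [h] at hix
      exact hi hix
    obtain ⟨m, hm⟩ := exists_ne (i (v' s))
    rw [hL.step (x := v' s) (w := v t) (by simp [hx, hxt]) hi m n]
    exact ih _ _ _ ⟨s, hx', by simpa using hm.symm⟩
  · exact ih _ _ _ ⟨s, hx', hix⟩

theorem exists_mixedDiff_eq [∀ v, Nontrivial (I v)] {d : ℕ} (hd : 2 ≤ d) {𝔭 𝔭' : V → Finset V}
    {v v' : Fin d ≃ V} (hv : IsVertexNumbering 𝔭 v) (hv' : IsVertexNumbering 𝔭' v')
    (hne : ∀ j : Fin d, 1 ≤ j.val → 𝔭 (v j) ≠ 𝔭' (v' j))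
    {L : ((∀ v, I v) → ℕ) → ℝ} (hL : MixedDiffLocal 𝔭 L) (hL' : MixedDiffLocal 𝔭' L) :
    ∃ φ : ℕ → ℝ, ∀ (i i' : ∀ v, I v) n, i ≠ i' → mixedDiff L i i' n = φ (∑ x, n x) := by
  have ha := hv.first ⟨0, by omega⟩ rfl
  have hb := hv'.first ⟨0, by omega⟩ rfl
  -- The parent set at the second position is the singleton of the root, so the hypothesis there
  -- says that the roots differ.
  have hab : v ⟨0, by omega⟩ ≠ v' ⟨0, by omega⟩ := by
    intro h
    apply hne ⟨1, by omega⟩ le_rfl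
    rw [hv.next ⟨0, by omega⟩ ⟨1, by omega⟩ rfl, hv'.next ⟨0, by omega⟩ ⟨1, by omega⟩ rfl,
      ha, hb, h]
  obtain ⟨φ, hφ⟩ := mixedDiff_eq_of_roots hL hL' hab ha hb
  refine ⟨φ, ?_⟩
  have key : ∀ (t : ℕ) (ht : t < d) (i i' : ∀ v, I v) n,
      (i (v ⟨t, ht⟩) ≠ i' (v ⟨t, ht⟩) ∨ i (v' ⟨t, ht⟩) ≠ i' (v' ⟨t, ht⟩)) →
      mixedDiff L i i' n = φ (∑ x, n x) := by
    intro t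
    induction t using Nat.strong_induction_on with
    | _ t ih =>
      intro ht i i' n h
      rcases Nat.eq_zero_or_pos t with rfl | h0
      · exact hφ i i' n h
      · rcases h with h | h
        · refine mixedDiff_succ_of_local hv hv' hL ⟨t, ht⟩ (hne ⟨t, ht⟩ h0) ?_ i i' n h
          rintro i i' n ⟨s, hs, h⟩
          exact ih s hs s.2 i i' n (Or.inr h)
        · refine mixedDiff_succ_of_local hv' hv hL' ⟨t, ht⟩ (hne ⟨t, ht⟩ h0).symm ?_ i i' n h
          rintro i i' n ⟨s, hs, h⟩
          exact ih s hs s.2 i i' n (Or.inl h)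
  intro i i' n h
  obtain ⟨x, hx⟩ := Function.ne_iff.mp h
  obtain ⟨t, rfl⟩ := v.surjective x
  exact key t t.2 i i' n (Or.inl hx)

end Combinatorics

/-! ### From constant mixed differences to the Dirichlet moments -/

section Moments

variable {ι : Type*} [Fintype ι] [DecidableEq ι]

theorem count_induction {C : (ι → ℕ) → Prop} (zero : C 0)
    (add : ∀ n i, C n → C (n + Pi.single i 1)) (n : ι → ℕ) : C n := by
  obtain ⟨N, hN⟩ : ∃ N, ∑ i, n i = N := ⟨_, rfl⟩
  induction N generalizing n with
  | zero =>
    have : n = 0 := by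
      ext i
      simpa using (Finset.sum_eq_zero_iff.mp hN) i (Finset.mem_univ i)
    exact this ▸ zero
  | succ N ih =>
    obtain ⟨i, -, hi⟩ : ∃ i ∈ Finset.univ, n i ≠ 0 := by
      apply Finset.exists_ne_zero_of_sum_ne_zero
      omega
    have e : n = (n - Pi.single i 1) + Pi.single i 1 := by
      ext j
      by_cases hj : j = i
      · subst hj
        simp
        omega
      · simp [hj]
    rw [e]
    apply add
    apply ih
    have h2 : ∑ j, n j = ∑ j, (n - Pi.single i 1 : ι → ℕ) j + 1 := by
      conv_lhs => rw [e]
      simp only [Pi.add_apply, Finset.sum_add_distrib]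
      simp
    omega

theorem sum_add_single (n : ι → ℕ) (i : ι) :
    ∑ j, (n + Pi.single i 1 : ι → ℕ) j = ∑ j, n j + 1 := by
  simp [Finset.sum_add_distrib]

/-- An observation j multiplies the predictive probability of every other cell by ρ(|n|), and
normalisation fixes that of j itself. Consistency under exchanging two observations gives a
recursion that determines ρ from ρ(0). -/
theorem predictive_of_mixed [Nontrivial ι] (M : (ι → ℕ) → ℝ) (hpos : ∀ n, 0 < M n)
    (hsum : ∀ n, ∑ i, M (n + Pi.single i 1) = M n) (ρ : ℕ → ℝ)
    (hρ : ∀ n i j, i ≠ j → M (n + Pi.single i 1 + Pi.single j 1) * M n =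
      ρ (∑ k, n k) * (M (n + Pi.single i 1) * M (n + Pi.single j 1)))
    (hlt : ∃ i, M (Pi.single i 1) ^ 2 < M (Pi.single i 1 + Pi.single i 1) * M 0) :
    ∃ α : ι → ℝ, (∀ i, 0 < α i) ∧
      ∀ n i, M (n + Pi.single i 1) * (∑ j, α j + ((∑ j, n j : ℕ) : ℝ)) = M n * (α i + n i) := by
  set q : (ι → ℕ) → ι → ℝ := fun n i => M (n + Pi.single i 1) / M n with hq
  have qpos : ∀ n i, 0 < q n i := fun n i => div_pos (hpos _) (hpos _)
  have qsum : ∀ n, ∑ i, q n i = 1 := by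
    intro n
    rw [hq]
    simp only [← Finset.sum_div, hsum, div_self (hpos n).ne']
  have qne : ∀ n i j, i ≠ j → q (n + Pi.single j 1) i = ρ (∑ k, n k) * q n i := by
    intro n i j hij
    have := hρ n j i hij.symm
    have h1 := (hpos n).ne'
    have h2 := (hpos (n + Pi.single j 1)).ne'
    simp only [hq]
    field_simp
    linarith
  have qeq : ∀ n j, q (n + Pi.single j 1) j = 1 - ρ (∑ k, n k) * (1 - q n j) := by
    intro n j
    have h1 := qsum (n + Pi.single j 1)
    have h2 := qsum n
    rw [← Finset.add_sum_erase _ _ (Finset.mem_univ j)] at h1 h2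
    rw [Finset.sum_congr rfl fun i hi => qne n i j (Finset.ne_of_mem_erase hi),
      ← Finset.mul_sum] at h1
    rw [show ∑ i ∈ Finset.univ.erase j, q n i = 1 - q n j by linarith] at h1
    linarith
  obtain ⟨a, b, hab⟩ := exists_pair_ne ι
  -- Compute the predictive probability of a after observing a and b, in either order, and equate
  -- the results.
  have hrec : ∀ N, ρ (N + 1) * (2 - ρ N) = 1 := by
    intro N
    set n : ι → ℕ := Pi.single a N
    have hn : ∑ k, n k = N := by simp [n]
    have e1 := qne (n + Pi.single a 1) a b hab
    have e2 := qeq (n + Pi.single b 1) a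
    rw [add_right_comm] at e2
    rw [sum_add_single, hn, qeq, hn] at e1
    rw [sum_add_single, hn, qne n a b hab, hn, e1] at e2
    linarith
  have hρ0 : 0 < ρ 0 := by
    have h := qne 0 a b hab
    simp only [Pi.zero_apply, Finset.sum_const_zero] at h
    have h1 := qpos (0 + Pi.single b 1) a
    rw [h] at h1
    exact pos_of_mul_pos_left h1 (qpos 0 a).le
  -- Positive variance of one cell means that observing it raises its predictive probability, which
  -- is impossible if ρ(0) ≥ 1.
  have hρ1 : ρ 0 < 1 := by
    obtain ⟨i, hi⟩ := hlt
    have h := qeq 0 i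
    simp only [Pi.zero_apply, Finset.sum_const_zero] at h
    have h1 : q 0 i < q (0 + Pi.single i 1) i := by
      simp only [hq, zero_add]
      rw [div_lt_div_iff₀ (hpos _) (hpos _)]
      nlinarith
    have h2 : q 0 i < 1 := by
      obtain ⟨j, hj⟩ := exists_ne i
      rw [← qsum 0]
      exact Finset.single_lt_sum hj (Finset.mem_univ _) (Finset.mem_univ _) (qpos 0 j)
        fun k _ _ => (qpos 0 k).le
    by_contra! h3
    nlinarith
  -- A will be ∑ α: it solves ρ(0) = A / (A + 1).
  set A : ℝ := ρ 0 / (1 - ρ 0) with hA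
  have hA0 : 0 < A := div_pos hρ0 (by linarith)
  have hρA : ∀ N : ℕ, ρ N = (A + N) / (A + N + 1) := by
    intro N
    induction N with
    | zero =>
      have : 1 - ρ 0 ≠ 0 := by linarith
      rw [hA]
      field_simp
      simp
    | succ N ih =>
      have h := hrec N
      have h3 : (0 : ℝ) < A + N + 1 := by positivity
      have h4 : (0 : ℝ) < A + N + 2 := by positivity
      rw [ih, show 2 - (A + N) / (A + N + 1) = (A + N + 2) / (A + N + 1) by field_simp; ring] at h
      push_cast
      rw [eq_div_iff (by positivity)]
      field_simp at h
      linarith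
  have key : ∀ n i, q n i * (A + ((∑ j, n j : ℕ) : ℝ)) = A * q 0 i + n i := by
    intro n
    induction n using count_induction with
    | zero => intro i; simp [mul_comm]
    | add n j ih =>
      intro i
      have h3 : (0 : ℝ) < A + ((∑ k, n k : ℕ) : ℝ) + 1 := by positivity
      have ihi := ih i
      rw [sum_add_single]
      by_cases hij : i = j
      · subst hij
        rw [qeq, hρA]
        simp only [Pi.add_apply, Pi.single_eq_same, Nat.cast_add, Nat.cast_one]
        field_simp
        linear_combination (A + ((∑ k, n k : ℕ) : ℝ) + 1) * ihi
      · rw [qne n i j hij, hρA]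
        simp only [Pi.add_apply, Pi.single_eq_of_ne hij, add_zero, Nat.cast_add, Nat.cast_one]
        rw [← ihi]
        field_simp
        ring
  refine ⟨fun i => A * q 0 i, fun i => mul_pos hA0 (qpos 0 i), fun n i => ?_⟩
  rw [← Finset.mul_sum, qsum, mul_one, ← key n i]
  have := (hpos n).ne'
  simp only [hq]
  field_simp

/-- A positive family satisfying the recursion of the Dirichlet moments is the family of
Dirichlet moments. -/
theorem eq_gamma_of_predictive (M : (ι → ℕ) → ℝ) (h0 : M 0 = 1) [Nonempty ι] (α : ι → ℝ)
    (hα : ∀ i, 0 < α i)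
    (h : ∀ n i, M (n + Pi.single i 1) * (∑ j, α j + ((∑ j, n j : ℕ) : ℝ)) = M n * (α i + n i))
    (n : ι → ℕ) :
    M n = Real.Gamma (∑ i, α i) / (∏ i, Real.Gamma (α i)) *
      ((∏ i, Real.Gamma (α i + n i)) / Real.Gamma (∑ i, (α i + n i))) := by
  have hA : 0 < ∑ i, α i := Finset.sum_pos (fun i _ => hα i) Finset.univ_nonempty
  have hP : 0 < ∏ i, Real.Gamma (α i) := Finset.prod_pos fun i _ => Real.Gamma_pos_of_pos (hα i)
  have hG := Real.Gamma_pos_of_pos hA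
  induction n using count_induction with
  | zero =>
    simp only [h0, Pi.zero_apply, Nat.cast_zero, add_zero]
    field_simp
  | add n i ih =>
    have hN : (0 : ℝ) < ∑ j, α j + ((∑ j, n j : ℕ) : ℝ) := by positivity
    have hs : ∑ j, (α j + ((n + Pi.single i 1 : ι → ℕ) j : ℕ)) = ∑ j, (α j + (n j : ℝ)) + 1 := by
      rw [Finset.sum_add_distrib, Finset.sum_add_distrib, ← Nat.cast_sum, ← Nat.cast_sum,
        sum_add_single]
      push_cast
      ring
    have hs' : ∑ j, (α j + (n j : ℝ)) = ∑ j, α j + ((∑ j, n j : ℕ) : ℝ) := by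
      rw [Finset.sum_add_distrib]
      push_cast
      ring
    have hi : 0 < α i + n i := add_pos_of_pos_of_nonneg (hα i) (Nat.cast_nonneg _)
    have hp : ∏ j, Real.Gamma (α j + ((n + Pi.single i 1 : ι → ℕ) j : ℕ)) =
        (α i + n i) * ∏ j, Real.Gamma (α j + n j) := by
      rw [← Finset.mul_prod_erase _ _ (Finset.mem_univ i),
        ← Finset.mul_prod_erase _ (fun j => Real.Gamma (α j + n j)) (Finset.mem_univ i), ← mul_assoc]
      congr 1
      · rw [← Real.Gamma_add_one hi.ne']
        simp [add_assoc]
      · refine Finset.prod_congr rfl fun j hj => ?_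
        simp [Finset.ne_of_mem_erase hj]
    have hg := Real.Gamma_pos_of_pos hN
    rw [hs, hp, hs', Real.Gamma_add_one hN.ne']
    rw [hs'] at ih
    rw [eq_div_of_mul_eq hN.ne' (h n i), ih]
    field_simp

end Moments

/-! ### The Dirichlet integral and the moments of the Dirichlet law -/

section DirichletIntegral

/-- The power function `y ↦ y ^ (a - 1)` on the positive half-line, extended by zero. -/
noncomputable def posPow (a y : ℝ) : ENNReal :=
  (Set.Ioi (0 : ℝ)).indicator (fun y => ENNReal.ofReal (y ^ (a - 1))) y

theorem measurable_posPow (a : ℝ) : Measurable (posPow a) := by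
  unfold posPow
  exact Measurable.indicator (by fun_prop) measurableSet_Ioi

theorem posPow_of_nonpos (a : ℝ) {y : ℝ} (hy : y ≤ 0) : posPow a y = 0 := by
  simp [posPow, hy]

theorem posPow_ne_top (a y : ℝ) : posPow a y ≠ ⊤ := by
  rcases le_or_gt y 0 with hy | hy
  · simp [posPow_of_nonpos a hy]
  · simp [posPow, hy]

theorem posPow_mul (a : ℝ) {s : ℝ} (hs : 0 < s) (y : ℝ) :
    posPow a (s * y) = ENNReal.ofReal (s ^ (a - 1)) * posPow a y := by
  rcases le_or_gt y 0 with hy | hy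
  · rw [posPow_of_nonpos a hy, posPow_of_nonpos a (mul_nonpos_of_nonneg_of_nonpos hs.le hy),
      mul_zero]
  · have hsy : 0 < s * y := mul_pos hs hy
    simp only [posPow, Set.mem_Ioi, hy, hsy, Set.indicator_of_mem]
    rw [Real.mul_rpow hs.le hy.le, ENNReal.ofReal_mul (by positivity)]

theorem lintegral_posPow_mul_exp {a : ℝ} (ha : 0 < a) :
    ∫⁻ y, posPow a y * ENNReal.ofReal (Real.exp (-y)) = ENNReal.ofReal (Real.Gamma a) := by
  rw [Real.Gamma_eq_integral ha, ofReal_integral_eq_lintegral_ofReal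
    (Real.GammaIntegral_convergent ha), ← lintegral_indicator measurableSet_Ioi]
  · congr with y
    by_cases hy : 0 < y
    · simp only [posPow, Set.mem_Ioi, hy, Set.indicator_of_mem]
      rw [mul_comm, ← ENNReal.ofReal_mul (Real.exp_pos _).le]
    · simp [posPow, hy]
  · filter_upwards [self_mem_ae_restrict measurableSet_Ioi] with y hy
    have : 0 < y := hy
    positivity

/-- Reduced to the product formula for Bochner integrals, whence the finiteness assumptions. -/
theorem lintegral_pi_prod_eq_prod {κ : Type*} [Fintype κ] (f : κ → ℝ → ENNReal)
    (hf : ∀ j, Measurable (f j)) (hfin : ∀ j t, f j t ≠ ⊤) (hint : ∀ j, ∫⁻ t, f j t ≠ ⊤) :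
    ∫⁻ y : κ → ℝ, ∏ j, f j (y j) = ∏ j, ∫⁻ t, f j t := by
  have hI : ∀ j, Integrable fun t => (f j t).toReal := fun j =>
    integrable_toReal_of_lintegral_ne_top (hf j).aemeasurable (hint j)
  have h1 : ∀ j, ∫⁻ t, f j t = ENNReal.ofReal (∫ t, (f j t).toReal) := by
    intro j
    rw [ofReal_integral_eq_lintegral_ofReal (hI j) (ae_of_all _ fun t => ENNReal.toReal_nonneg)]
    simp only [ENNReal.ofReal_toReal (hfin j _)]
  simp only [h1]
  rw [← ENNReal.ofReal_prod_of_nonneg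
    fun j _ => integral_nonneg fun t => ENNReal.toReal_nonneg,
    ← integral_fintype_prod_volume_eq_prod (fun j t => (f j t).toReal), volume_pi,
    ofReal_integral_eq_lintegral_ofReal (Integrable.fintype_prod_dep hI)
      (ae_of_all _ fun y => Finset.prod_nonneg fun j _ => ENNReal.toReal_nonneg)]
  congr with y
  rw [ENNReal.ofReal_prod_of_nonneg fun j _ => ENNReal.toReal_nonneg]
  simp only [ENNReal.ofReal_toReal (hfin _ _)]

variable {κ : Type*} [Fintype κ]

/-- The unnormalised Dirichlet density on the simplex of size `s`. -/
noncomputable def simplexKernel (a : κ → ℝ) (a₀ s : ℝ) (y : κ → ℝ) : ENNReal :=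
  (∏ j, posPow (a j) (y j)) * posPow a₀ (s - ∑ j, y j)

theorem measurable_simplexKernel (a : κ → ℝ) (a₀ : ℝ) :
    Measurable fun z : ℝ × (κ → ℝ) => simplexKernel a a₀ z.1 z.2 := by
  unfold simplexKernel
  refine Measurable.mul (Finset.measurable_prod _ fun j _ => ?_) ?_
  · exact (measurable_posPow _).comp (by fun_prop)
  · exact (measurable_posPow _).comp (by fun_prop)

theorem simplexKernel_of_nonpos (a : κ → ℝ) (a₀ : ℝ) {s : ℝ} (hs : s ≤ 0) (y : κ → ℝ) :
    simplexKernel a a₀ s y = 0 := by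
  unfold simplexKernel
  by_cases h : ∀ j, 0 < y j
  · rw [posPow_of_nonpos, mul_zero]
    have := Finset.sum_nonneg fun j (_ : j ∈ Finset.univ) => (h j).le
    linarith
  · push Not at h
    obtain ⟨j, hj⟩ := h
    rw [Finset.prod_eq_zero (Finset.mem_univ j) (posPow_of_nonpos _ hj), zero_mul]

theorem simplexKernel_smul (a : κ → ℝ) (a₀ : ℝ) {s : ℝ} (hs : 0 < s) (y : κ → ℝ) :
    simplexKernel a a₀ s (s • y) =
      ENNReal.ofReal (s ^ (∑ j, a j + a₀ - 1 - Fintype.card κ)) * simplexKernel a a₀ 1 y := by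
  unfold simplexKernel
  have h1 : s - ∑ j, (s • y) j = s * (1 - ∑ j, y j) := by
    simp [← Finset.mul_sum, mul_sub]
  rw [h1, posPow_mul _ hs]
  simp only [Pi.smul_apply, smul_eq_mul, posPow_mul _ hs, Finset.prod_mul_distrib]
  rw [← ENNReal.ofReal_prod_of_nonneg (fun j _ => by positivity), mul_mul_mul_comm,
    ← ENNReal.ofReal_mul (Finset.prod_nonneg fun j _ => by positivity),
    ← Real.rpow_sum_of_pos hs, ← Real.rpow_add hs]
  congr 3
  simp [Finset.sum_sub_distrib]
  ring

/-- Homogeneity: rescale y by s. The Jacobian and the powers of s combine to the exponent ∑ a + a₀ -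
1. -/
theorem lintegral_simplexKernel_eq (a : κ → ℝ) (a₀ s : ℝ) :
    ∫⁻ y, simplexKernel a a₀ s y =
      posPow (∑ j, a j + a₀) s * ∫⁻ y, simplexKernel a a₀ 1 y := by
  rcases le_or_gt s 0 with hs | hs
  · simp [simplexKernel_of_nonpos _ _ hs, posPow_of_nonpos _ hs]
  · have hm : Measurable (simplexKernel a a₀ s) :=
      (measurable_simplexKernel a a₀).comp (measurable_prodMk_left (x := s))
    have h1 : ∫⁻ y, simplexKernel a a₀ s (s • y) =
        ENNReal.ofReal |(s ^ Fintype.card κ)⁻¹| * ∫⁻ y, simplexKernel a a₀ s y := by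
      rw [← lintegral_map hm (measurable_const_smul s), Measure.map_addHaar_smul _ hs.ne',
        lintegral_smul_measure]
      simp
    have hm1 : Measurable (simplexKernel a a₀ 1) :=
      (measurable_simplexKernel a a₀).comp (measurable_prodMk_left (x := (1 : ℝ)))
    simp only [simplexKernel_smul _ _ hs] at h1
    rw [lintegral_const_mul _ hm1] at h1
    have hc : (0 : ℝ) < s ^ Fintype.card κ := by positivity
    have h2 : ENNReal.ofReal (s ^ Fintype.card κ) * ENNReal.ofReal |(s ^ Fintype.card κ)⁻¹| = 1 := by
      rw [← ENNReal.ofReal_mul hc.le, abs_of_pos (inv_pos.mpr hc), mul_inv_cancel₀ hc.ne',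
        ENNReal.ofReal_one]
    rw [← one_mul (∫⁻ y, simplexKernel a a₀ s y), ← h2, mul_assoc, ← h1, ← mul_assoc,
      ← ENNReal.ofReal_mul hc.le, ← Real.rpow_natCast, ← Real.rpow_add hs]
    simp only [posPow, Set.mem_Ioi, hs, Set.indicator_of_mem]
    congr 3
    ring_nf

/-- The classical Gamma argument: write the product of Gamma functions as one multiple integral,
take the total s as a new variable, exchange the integrals, and integrate y out by homogeneity. -/
theorem lintegral_simplexKernel (a : κ → ℝ) (ha : ∀ j, 0 < a j) {a₀ : ℝ} (ha₀ : 0 < a₀) :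
    ENNReal.ofReal (Real.Gamma (∑ j, a j + a₀)) * ∫⁻ y, simplexKernel a a₀ 1 y =
      ENNReal.ofReal ((∏ j, Real.Gamma (a j)) * Real.Gamma a₀) := by
  have hA : 0 < ∑ j, a j + a₀ :=
    add_pos_of_nonneg_of_pos (Finset.sum_nonneg fun j _ => (ha j).le) ha₀
  have hG : ∀ j, 0 < Real.Gamma (a j) := fun j => Real.Gamma_pos_of_pos (ha j)
  have hme : Measurable fun t : ℝ => ENNReal.ofReal (Real.exp (-t)) := by fun_prop
  have hm := measurable_simplexKernel a a₀
  have hms : ∀ s, Measurable (simplexKernel a a₀ s) := fun s =>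
    hm.comp (measurable_prodMk_left (x := s))
  have hmp : Measurable fun y : κ → ℝ =>
      ∏ j, posPow (a j) (y j) * ENNReal.ofReal (Real.exp (-y j)) :=
    Finset.measurable_prod _ fun j _ =>
      ((measurable_posPow _).mul hme).comp (measurable_pi_apply j)
  rw [ENNReal.ofReal_mul (Finset.prod_nonneg fun j _ => (hG j).le),
    ENNReal.ofReal_prod_of_nonneg fun j _ => (hG j).le, ← lintegral_posPow_mul_exp ha₀,
    ← lintegral_posPow_mul_exp hA]
  simp only [← lintegral_posPow_mul_exp (ha _)]
  rw [← lintegral_pi_prod_eq_prod (fun j y => posPow (a j) y * ENNReal.ofReal (Real.exp (-y)))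
      (fun j => (measurable_posPow _).mul hme)
      (fun j t => ENNReal.mul_ne_top (posPow_ne_top _ _) ENNReal.ofReal_ne_top)
      (fun j => by rw [lintegral_posPow_mul_exp (ha j)]; exact ENNReal.ofReal_ne_top),
    ← lintegral_mul_const _ hmp,
    ← lintegral_mul_const (f := fun y => posPow (∑ j, a j + a₀) y * ENNReal.ofReal (Real.exp (-y)))
      _ ((measurable_posPow _).mul hme)]
  -- Substitute t = s - ∑ y; the exponentials then combine to exp(-s).
  have h1 : ∀ y : κ → ℝ, (∏ j, posPow (a j) (y j) * ENNReal.ofReal (Real.exp (-y j))) *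
      ∫⁻ t, posPow a₀ t * ENNReal.ofReal (Real.exp (-t)) =
      ∫⁻ s, simplexKernel a a₀ s y * ENNReal.ofReal (Real.exp (-s)) := by
    intro y
    rw [← lintegral_sub_right_eq_self
      (fun t => posPow a₀ t * ENNReal.ofReal (Real.exp (-t))) (∑ j, y j),
      ← lintegral_const_mul _ (by
        exact ((measurable_posPow _).mul hme).comp (measurable_sub_const _))]
    congr with s
    unfold simplexKernel
    rw [Finset.prod_mul_distrib, mul_mul_mul_comm,
      ← ENNReal.ofReal_prod_of_nonneg (fun j _ => (Real.exp_pos _).le),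
      ← ENNReal.ofReal_mul (Finset.prod_nonneg fun j _ => (Real.exp_pos _).le),
      ← Real.exp_sum, ← Real.exp_add]
    congr 3
    rw [Finset.sum_neg_distrib]
    ring
  simp only [h1]
  rw [lintegral_lintegral_swap]
  · congr with s
    rw [lintegral_mul_const _ (hms s), lintegral_simplexKernel_eq a a₀ s]
    ring
  · exact ((hm.comp measurable_swap).mul (hme.comp measurable_snd)).aemeasurable

variable {ι : Type*} [Fintype ι] [DecidableEq ι]

theorem prod_eq_mul_prod_subtype {M : Type*} [CommMonoid M] (i₀ : ι) (f : ι → M) :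
    ∏ i, f i = (∏ j : {i : ι // i ≠ i₀}, f j) * f i₀ := by
  rw [← Finset.mul_prod_erase _ _ (Finset.mem_univ i₀),
    Finset.prod_subtype (p := fun i => i ≠ i₀) _ (by simp), mul_comm]

theorem simplexCompletion_self (i₀ : ι) (x : {i : ι // i ≠ i₀} → ℝ) :
    simplexCompletion i₀ x i₀ = 1 - ∑ j, x j := by
  simp [simplexCompletion]

theorem simplexCompletion_coe (i₀ : ι) (x : {i : ι // i ≠ i₀} → ℝ) (j : {i : ι // i ≠ i₀}) :
    simplexCompletion i₀ x j = x j := by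
  rw [simplexCompletion, dif_neg j.2]

theorem simplexCompletion_sum (i₀ : ι) (x : {i : ι // i ≠ i₀} → ℝ) :
    ∑ i, simplexCompletion i₀ x i = 1 := by
  trans ∑ j : {i : ι // i ≠ i₀}, simplexCompletion i₀ x j + simplexCompletion i₀ x i₀
  -- The additive splitting is the multiplicative one read in `Multiplicative ℝ`.
  · exact prod_eq_mul_prod_subtype (M := Multiplicative ℝ) i₀ _
  · simp only [simplexCompletion_self, simplexCompletion_coe, add_sub_cancel]

theorem simplexCompletion_pos {i₀ : ι} {x : {i : ι // i ≠ i₀} → ℝ} (hx : x ∈ openSimplex i₀)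
    (i : ι) : 0 < simplexCompletion i₀ x i := by
  unfold simplexCompletion
  split_ifs with h
  · linarith [hx.2]
  · exact (hx.1 _).1

theorem mem_openSimplex_iff {i₀ : ι} {x : {i : ι // i ≠ i₀} → ℝ} :
    x ∈ openSimplex i₀ ↔ ∀ i, 0 < simplexCompletion i₀ x i := by
  refine ⟨simplexCompletion_pos, fun h => ?_⟩
  have h0 : ∑ j, x j < 1 := by simpa [simplexCompletion_self] using h i₀
  have h1 : ∀ j, 0 < x j := fun j => by simpa [simplexCompletion_coe] using h j
  refine ⟨fun j => ⟨h1 j, lt_of_le_of_lt ?_ h0⟩, h0⟩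
  exact Finset.single_le_sum (fun j _ => (h1 j).le) (Finset.mem_univ j)

theorem simplexKernel_one_eq (α : ι → ℝ) (i₀ : ι) (x : {i : ι // i ≠ i₀} → ℝ) :
    simplexKernel (fun j : {i : ι // i ≠ i₀} => α j) (α i₀) 1 x =
      (openSimplex i₀).indicator
        (fun x => ENNReal.ofReal (∏ i, simplexCompletion i₀ x i ^ (α i - 1))) x := by
  have e : simplexKernel (fun j : {i : ι // i ≠ i₀} => α j) (α i₀) 1 x =
      ∏ i, posPow (α i) (simplexCompletion i₀ x i) := by
    rw [prod_eq_mul_prod_subtype i₀, simplexKernel]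
    simp only [simplexCompletion_self, simplexCompletion_coe]
  rw [e]
  by_cases hx : x ∈ openSimplex i₀
  · rw [Set.indicator_of_mem hx, ENNReal.ofReal_prod_of_nonneg fun i _ =>
      Real.rpow_nonneg (simplexCompletion_pos hx i).le _]
    refine Finset.prod_congr rfl fun i _ => ?_
    simp [posPow, simplexCompletion_pos hx i]
  · rw [Set.indicator_of_notMem hx]
    rw [mem_openSimplex_iff] at hx
    push Not at hx
    obtain ⟨i, hi⟩ := hx
    exact Finset.prod_eq_zero (Finset.mem_univ i) (posPow_of_nonpos _ hi)

theorem lintegral_dirichlet_kernel (α : ι → ℝ) (hα : ∀ i, 0 < α i) (i₀ : ι) :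
    ∫⁻ x, (openSimplex i₀).indicator
        (fun x => ENNReal.ofReal (∏ i, simplexCompletion i₀ x i ^ (α i - 1))) x =
      ENNReal.ofReal ((∏ i, Real.Gamma (α i)) / Real.Gamma (∑ i, α i)) := by
  have h := lintegral_simplexKernel (fun j : {i : ι // i ≠ i₀} => α j) (fun j => hα j) (hα i₀)
  have hs : ∑ j : {i : ι // i ≠ i₀}, α j + α i₀ = ∑ i, α i :=
    (prod_eq_mul_prod_subtype (M := Multiplicative ℝ) i₀ α).symm
  have hG : 0 < Real.Gamma (∑ i, α i) :=
    Real.Gamma_pos_of_pos (Finset.sum_pos (fun i _ => hα i) ⟨i₀, Finset.mem_univ _⟩)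
  rw [hs, ← prod_eq_mul_prod_subtype i₀ fun i => Real.Gamma (α i)] at h
  simp only [simplexKernel_one_eq] at h
  rw [ENNReal.ofReal_div_of_pos hG, ← h, mul_comm, ENNReal.mul_div_cancel_right
    (by simpa using hG) ENNReal.ofReal_ne_top]

theorem measurableSet_openSimplex (i₀ : ι) : MeasurableSet (openSimplex i₀) := by
  have : openSimplex i₀ = ⋂ i, {x | 0 < simplexCompletion i₀ x i} := by
    ext x
    simp [mem_openSimplex_iff]
  rw [this]
  exact MeasurableSet.iInter fun i => measurableSet_lt measurable_const
    ((measurable_pi_apply i).comp (measurable_simplexCompletion i₀))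

theorem measurable_dirichletDensity (α : ι → ℝ) (i₀ : ι) :
    Measurable (dirichletDensity α i₀) := by
  refine Measurable.indicator (Measurable.const_mul (Finset.measurable_prod _ fun i _ => ?_) _)
    (measurableSet_openSimplex i₀)
  exact ((measurable_pi_apply i).comp (measurable_simplexCompletion i₀)).pow_const _

/-- Multiplying the density by a monomial shifts α to α + n, so each moment is a quotient of two
normalising constants. -/
theorem lintegral_prod_pow_dirichletMeasure (α : ι → ℝ) (hα : ∀ i, 0 < α i) (i₀ : ι)
    (n : ι → ℕ) :
    ∫⁻ y, ENNReal.ofReal (∏ i, y i ^ n i) ∂(dirichletMeasure α i₀) =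
      ENNReal.ofReal (Real.Gamma (∑ i, α i) / (∏ i, Real.Gamma (α i)) *
      ((∏ i, Real.Gamma (α i + n i)) / Real.Gamma (∑ i, (α i + n i)))) := by
  have hd := (measurable_dirichletDensity α i₀).ennreal_ofReal
  have hf : Measurable fun y : ι → ℝ => ENNReal.ofReal (∏ i, y i ^ n i) := by fun_prop
  have hA : 0 < ∑ i, α i := Finset.sum_pos (fun i _ => hα i) ⟨i₀, Finset.mem_univ _⟩
  have hP : 0 < ∏ i, Real.Gamma (α i) := Finset.prod_pos fun i _ => Real.Gamma_pos_of_pos (hα i)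
  have hc := div_nonneg (Real.Gamma_pos_of_pos hA).le hP.le
  rw [dirichletMeasure, lintegral_map hf (measurable_simplexCompletion i₀),
    lintegral_withDensity_eq_lintegral_mul _ hd
      (g := fun x => ENNReal.ofReal (∏ i, simplexCompletion i₀ x i ^ n i))
      (hf.comp (measurable_simplexCompletion i₀)),
    ENNReal.ofReal_mul hc, ← lintegral_dirichlet_kernel (fun i => α i + n i)
      (fun i => add_pos_of_pos_of_nonneg (hα i) (Nat.cast_nonneg _)) i₀,
    ← lintegral_const_mul' _ _ ENNReal.ofReal_ne_top]
  congr with x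
  simp only [Pi.mul_apply, dirichletDensity]
  by_cases hx : x ∈ openSimplex i₀
  · have hpos := simplexCompletion_pos hx
    rw [Set.indicator_of_mem hx, Set.indicator_of_mem hx, ENNReal.ofReal_mul hc, mul_assoc,
      ← ENNReal.ofReal_mul (Finset.prod_nonneg fun i _ => Real.rpow_nonneg (hpos i).le _),
      ← Finset.prod_mul_distrib]
    congr 3 with i
    rw [← Real.rpow_natCast, ← Real.rpow_add (hpos i)]
    ring_nf
  · simp [hx]

theorem ae_mem_Icc_dirichletMeasure (α : ι → ℝ) (i₀ : ι) :
    ∀ᵐ y ∂(dirichletMeasure α i₀), ∀ i, y i ∈ Set.Icc (0 : ℝ) 1 := by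
  have hd := (measurable_dirichletDensity α i₀).ennreal_ofReal
  have hS : MeasurableSet {y : ι → ℝ | ∀ i, y i ∈ Set.Icc (0 : ℝ) 1} := by
    rw [Set.ofPred_forall]
    exact MeasurableSet.iInter fun i => measurableSet_Icc.preimage (measurable_pi_apply i)
  rw [dirichletMeasure, ae_map_iff (measurable_simplexCompletion i₀).aemeasurable hS,
    ae_withDensity_iff hd]
  refine Filter.Eventually.of_forall fun x hx i => ?_
  have hx' : x ∈ openSimplex i₀ := by
    by_contra h
    simp [dirichletDensity, h] at hx
  have hpos := simplexCompletion_pos hx'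
  refine ⟨(hpos i).le, ?_⟩
  rw [← simplexCompletion_sum i₀ x]
  exact Finset.single_le_sum (fun j _ => (hpos j).le) (Finset.mem_univ i)

end DirichletIntegral

/-! ### Moments determine a law on the unit cube -/

section MomentProblem

variable {ι : Type*} [Fintype ι]

/-- The coordinate functions of the cube, as bounded continuous functions. -/
def cubeCoord (i : ι) : BoundedContinuousFunction (ι → unitInterval) ℝ :=
  BoundedContinuousFunction.mkOfCompact ⟨fun x => (x i : ℝ), by fun_prop⟩

/-- The polynomial functions on the cube. -/
noncomputable def cubePolynomials (ι : Type*) [Fintype ι] :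
    StarSubalgebra ℝ (BoundedContinuousFunction (ι → unitInterval) ℝ) where
  toSubalgebra := (MvPolynomial.aeval (R := ℝ) (cubeCoord (ι := ι))).range
  star_mem' := by
    intro a ha
    have : star a = a := by
      ext x
      simp
    rwa [this]

/-- Polynomials form a point-separating algebra of bounded continuous functions, and linearity
reduces them to monomials. -/
theorem cube_ext_of_moments (μ ν : Measure (ι → unitInterval)) [IsFiniteMeasure μ]
    [IsFiniteMeasure ν]
    (h : ∀ n : ι → ℕ, ∫ x, ∏ i, (x i : ℝ) ^ n i ∂μ = ∫ x, ∏ i, (x i : ℝ) ^ n i ∂ν) : μ = ν := by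
  refine ext_of_forall_mem_subalgebra_integral_eq_of_polish (𝕜 := ℝ) (A := cubePolynomials ι) ?_ ?_
  · intro x y hxy
    obtain ⟨i, hi⟩ := Function.ne_iff.mp hxy
    refine ⟨_, ⟨_, ⟨cubeCoord i, ⟨MvPolynomial.X i, by simp⟩, rfl⟩, rfl⟩, ?_⟩
    intro h
    exact hi (Subtype.ext h)
  · rintro _ ⟨q, rfl⟩
    have hmono : ∀ (m : ι →₀ ℕ) (x : ι → unitInterval),
        (MvPolynomial.aeval cubeCoord (MvPolynomial.monomial m (1 : ℝ)) :
          BoundedContinuousFunction (ι → unitInterval) ℝ) x = ∏ i, (x i : ℝ) ^ m i := by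
      intro m x
      rw [MvPolynomial.aeval_monomial, Finsupp.prod_fintype _ _ (by simp)]
      simp [cubeCoord]
    induction q using MvPolynomial.induction_on' with
    | monomial m a =>
      have e : ∀ x, (MvPolynomial.aeval cubeCoord (MvPolynomial.monomial m a) :
          BoundedContinuousFunction (ι → unitInterval) ℝ) x = a * ∏ i, (x i : ℝ) ^ m i := by
        intro x
        rw [← hmono, ← mul_one a, ← smul_eq_mul, ← MvPolynomial.smul_monomial, map_smul]
        simp
      simp only [AlgHom.toRingHom_eq_coe, RingHom.coe_coe, e, integral_const_mul, h m]
    | add q r hq hr =>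
      simp only [AlgHom.toRingHom_eq_coe, RingHom.coe_coe, map_add,
        BoundedContinuousFunction.add_apply] at hq hr ⊢
      rw [integral_add (BoundedContinuousFunction.integrable _ _)
        (BoundedContinuousFunction.integrable _ _), hq, hr,
        integral_add (BoundedContinuousFunction.integrable _ _)
        (BoundedContinuousFunction.integrable _ _)]

theorem ext_of_lintegral_moments (μ ν : Measure (ι → ℝ)) [IsFiniteMeasure μ]
    (hμ : ∀ᵐ x ∂μ, ∀ i, x i ∈ Set.Icc (0 : ℝ) 1) (hν : ∀ᵐ x ∂ν, ∀ i, x i ∈ Set.Icc (0 : ℝ) 1)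
    (h : ∀ n : ι → ℕ, ∫⁻ x, ENNReal.ofReal (∏ i, x i ^ n i) ∂μ =
      ∫⁻ x, ENNReal.ofReal (∏ i, x i ^ n i) ∂ν) : μ = ν := by
  -- The moment of order zero is the total mass. Thus the Dirichlet law need not be normalised in
  -- advance.
  have : IsFiniteMeasure ν := ⟨by
    have h0 := h 0
    simp at h0
    rw [← h0]
    exact measure_lt_top _ _⟩
  let T : (ι → ℝ) → (ι → unitInterval) := fun x i => Set.projIcc 0 1 zero_le_one (x i)
  let S : (ι → unitInterval) → (ι → ℝ) := fun x i => x i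
  have hT : Measurable T := by
    refine measurable_pi_lambda _ fun i => ?_
    exact continuous_projIcc.measurable.comp (measurable_pi_apply i)
  have hS : Measurable S := by fun_prop
  have hST : ∀ x : ι → ℝ, (∀ i, x i ∈ Set.Icc (0 : ℝ) 1) → S (T x) = x := by
    intro x hx
    ext i
    simp only [S, T, Set.projIcc_of_mem _ (hx i)]
  have back : ∀ ξ : Measure (ι → ℝ), (∀ᵐ x ∂ξ, ∀ i, x i ∈ Set.Icc (0 : ℝ) 1) →
      (ξ.map T).map S = ξ := by
    intro ξ hξ
    rw [Measure.map_map hS hT]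
    conv_rhs => rw [← Measure.map_id (μ := ξ)]
    refine Measure.map_congr ?_
    filter_upwards [hξ] with x hx using hST x hx
  have mom : ∀ ξ : Measure (ι → ℝ), (∀ᵐ x ∂ξ, ∀ i, x i ∈ Set.Icc (0 : ℝ) 1) → ∀ n : ι → ℕ,
      ∫ x, ∏ i, (x i : ℝ) ^ n i ∂(ξ.map T) =
        (∫⁻ x, ENNReal.ofReal (∏ i, x i ^ n i) ∂ξ).toReal := by
    intro ξ hξ n
    rw [integral_eq_lintegral_of_nonneg_ae, lintegral_map _ hT]
    · congr 1
      refine lintegral_congr_ae ?_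
      filter_upwards [hξ] with x hx
      conv_rhs => rw [← hST x hx]
    · fun_prop
    · refine Filter.Eventually.of_forall fun x => Finset.prod_nonneg fun i _ => ?_
      exact pow_nonneg (x i).2.1 _
    · exact Measurable.aestronglyMeasurable (by fun_prop)
  rw [← back μ hμ, ← back ν hν]
  congr 1
  refine cube_ext_of_moments _ _ fun n => ?_
  rw [mom μ hμ, mom ν hν, h n]

end MomentProblem

/-! ### Moments of random cell probabilities under parameter independence -/

section Cells

theorem IsRandomCellProb.ae_mem_Icc {V : Type*} {I : V → Type*} [Fintype V]
    [DecidableEq V] [∀ v, Fintype (I v)] {Ω : Type*} [MeasurableSpace Ω] {P : Measure Ω}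
    {p : Ω → (∀ v, I v) → ℝ} (hp : IsRandomCellProb P p) :
    ∀ᵐ ω ∂P, ∀ i, p ω i ∈ Set.Icc (0 : ℝ) 1 := by
  filter_upwards [hp.pos, hp.sum_eq_one] with ω h0 h1 i
  refine ⟨(h0 i).le, ?_⟩
  rw [← h1]
  exact Finset.single_le_sum (fun j _ => (h0 j).le) (Finset.mem_univ i)

theorem IsRandomCellProb.integrable_monomial {V : Type*} {I : V → Type*} [Fintype V]
    [DecidableEq V] [∀ v, Fintype (I v)] {Ω : Type*} [MeasurableSpace Ω] {P : Measure Ω}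
    [IsFiniteMeasure P] {p : Ω → (∀ v, I v) → ℝ} (hp : IsRandomCellProb P p)
    (n : (∀ v, I v) → ℕ) : Integrable (fun ω => ∏ x, p ω x ^ n x) P := by
  have h : ∀ i, Measurable fun ω => p ω i := fun i => (measurable_pi_apply i).comp hp.measurable
  refine Integrable.of_bound (C := 1)
    (Finset.measurable_prod _ fun i _ => (h i).pow_const _).aestronglyMeasurable ?_
  filter_upwards [hp.ae_mem_Icc] with ω hω
  rw [Real.norm_of_nonneg (Finset.prod_nonneg fun i _ => pow_nonneg (hω i).1 _)]
  exact Finset.prod_le_one (fun i _ => pow_nonneg (hω i).1 _)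
    fun i _ => pow_le_one₀ (hω i).1 (hω i).2

variable {V : Type*} {I : V → Type*} [Fintype V] [DecidableEq V]
  [∀ v, Fintype (I v)] [∀ v, DecidableEq (I v)]

theorem marginalProb_pos {q : (∀ v, I v) → ℝ} (hq : ∀ i, 0 < q i) (D : Finset V)
    (i : ∀ v, I v) : 0 < marginalProb q D (D.restrict i) :=
  Finset.sum_pos (fun x _ => hq x) ⟨i, by simp⟩

theorem condCellProb_eq_div (q : (∀ v, I v) → ℝ) (v : V) (D : Finset V) (i : ∀ v, I v) :
    condCellProb q v D (D.restrict i) (i v) =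
      marginalProb q (insert v D) ((insert v D).restrict i) / marginalProb q D (D.restrict i) := by
  unfold condCellProb
  congr 1
  unfold marginalProb
  refine Finset.sum_congr (Finset.filter_congr fun x _ => ?_) fun _ _ => rfl
  simp only [funext_iff, Finset.restrict, Subtype.forall, Finset.mem_insert, forall_eq_or_imp]
  exact and_comm

/-- The chain rule: each factor is a quotient of marginals on consecutive initial segments of the
numbering, and the product telescopes. -/
theorem prod_condCellProb {d : ℕ} {𝔭 : V → Finset V} {v : Fin d ≃ V}
    (hv : IsVertexNumbering 𝔭 v) {q : (∀ v, I v) → ℝ} (hq : ∀ i, 0 < q i)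
    (hq1 : ∑ i, q i = 1) (i : ∀ v, I v) :
    ∏ u, condCellProb q u (𝔭 u) ((𝔭 u).restrict i) (i u) = q i := by
  set S : ℕ → Finset V := fun t => Finset.univ.filter fun u => ((v.symm u : Fin d) : ℕ) < t
  have hS : ∀ t : Fin d, 𝔭 (v t) = S t := by
    intro t
    ext x
    obtain ⟨s, rfl⟩ := v.surjective x
    simp [S, hv.mem_iff]
  have hS' : ∀ t : Fin d, insert (v t) (S t) = S (t + 1) := by
    intro t
    ext x
    obtain ⟨s, rfl⟩ := v.surjective x
    simp only [Finset.mem_insert, S, Finset.mem_filter, Finset.mem_univ, true_and,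
      Equiv.symm_apply_apply, v.injective.eq_iff, Fin.ext_iff]
    omega
  set m : ℕ → ℝ := fun t => marginalProb q (S t) ((S t).restrict i)
  have hfac : ∀ t : Fin d, condCellProb q (v t) (𝔭 (v t)) ((𝔭 (v t)).restrict i) (i (v t)) =
      m (t + 1) / m t := by
    intro t
    rw [condCellProb_eq_div]
    simp only [m]
    rw [← hS' t, ← hS t]
  rw [← v.prod_comp]
  simp only [hfac]
  have htel : ∀ k, ∏ t ∈ Finset.range k, m (t + 1) / m t = m k / m 0 := by
    intro k
    have h : ∀ t, m t ≠ 0 := fun t => (marginalProb_pos hq _ i).ne'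
    induction k with
    | zero => simp [h]
    | succ k ih => rw [Finset.prod_range_succ, ih, mul_comm, div_mul_div_cancel₀ (h k)]
  rw [Fin.prod_univ_eq_prod_range (fun t => m (t + 1) / m t) d, htel]
  have h0 : m 0 = 1 := by
    rw [← hq1]
    simp only [m, marginalProb]
    refine Finset.sum_congr (Finset.filter_true_of_mem fun x _ => ?_) fun _ _ => rfl
    ext ⟨u, hu⟩
    simp [S] at hu
  have hd : m d = q i := by
    simp only [m, marginalProb]
    rw [Finset.sum_eq_single_of_mem i (by simp)]
    intro x hx hxi
    exfalso
    apply hxi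
    ext u
    exact congrFun (Finset.mem_filter.mp hx).2 ⟨u, by simp [S]⟩
  rw [h0, hd, div_one]

theorem prod_pow_eq_prod_familyCount {d : ℕ} {𝔭 : V → Finset V} {v : Fin d ≃ V}
    (hv : IsVertexNumbering 𝔭 v) {q : (∀ v, I v) → ℝ} (hq : ∀ i, 0 < q i)
    (hq1 : ∑ i, q i = 1) (n : (∀ v, I v) → ℕ) :
    ∏ x, q x ^ n x = ∏ s : (v : V) × (∀ u : 𝔭 v, I u), ∏ m : I s.1,
      condCellProb q s.1 (𝔭 s.1) s.2 m ^ familyCount 𝔭 s n m := by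
  have h1 : ∀ (s : (v : V) × (∀ u : 𝔭 v, I u)) (m : I s.1),
      condCellProb q s.1 (𝔭 s.1) s.2 m ^ familyCount 𝔭 s n m =
      ∏ x, if (𝔭 s.1).restrict x = s.2 ∧ x s.1 = m then
        condCellProb q s.1 (𝔭 s.1) s.2 m ^ n x else 1 := by
    intro s m
    rw [familyCount, ← Finset.prod_pow_eq_pow_sum]
    refine Finset.prod_congr rfl fun x _ => ?_
    split_ifs <;> simp
  simp only [h1]
  simp only [Finset.prod_comm (s := (Finset.univ : Finset (I _)))]
  rw [Finset.prod_comm]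
  refine Finset.prod_congr rfl fun x _ => ?_
  rw [Fintype.prod_sigma]
  conv_lhs => rw [← prod_condCellProb hv hq hq1 x, ← Finset.prod_pow]
  refine Finset.prod_congr rfl fun u _ => ?_
  rw [Finset.prod_eq_single ((𝔭 u).restrict x), Finset.prod_eq_single (x u)]
  · simp
  · intro m _ hm
    simp [hm.symm]
  · simp
  · intro k _ hk
    simp [hk.symm]
  · simp

variable {Ω : Type*} [MeasurableSpace Ω] {P : Measure Ω} {p : Ω → (∀ v, I v) → ℝ}

theorem measurable_dagParameter (hp : Measurable p) (𝔭 : V → Finset V)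
    (s : (v : V) × (∀ u : 𝔭 v, I u)) : Measurable (dagParameter p 𝔭 s) := by
  refine measurable_pi_lambda _ fun m => ?_
  have h : ∀ i, Measurable fun ω => p ω i := fun i => (measurable_pi_apply i).comp hp
  exact (Finset.measurable_sum _ fun i _ => h i).div (Finset.measurable_sum _ fun i _ => h i)

/-- The mixed moments of a random vector. -/
noncomputable def mixedMoment {ι : Type*} [Fintype ι] (P : Measure Ω) (p : Ω → ι → ℝ)
    (n : ι → ℕ) : ℝ :=
  ∫ ω, ∏ x, p ω x ^ n x ∂P

theorem IsRandomCellProb.mixedMoment_pos [IsProbabilityMeasure P] (hp : IsRandomCellProb P p)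
    (n : (∀ v, I v) → ℕ) : 0 < mixedMoment P p n := by
  have hpos : ∀ᵐ ω ∂P, 0 < ∏ x, p ω x ^ n x := by
    filter_upwards [hp.pos] with ω hω
    exact Finset.prod_pos fun i _ => pow_pos (hω i) _
  refine (integral_nonneg_of_ae (hpos.mono fun ω h => h.le)).lt_of_ne' fun h0 => ?_
  rw [integral_eq_zero_iff_of_nonneg_ae (hpos.mono fun ω h => h.le) (hp.integrable_monomial n)] at h0
  obtain ⟨ω, h1, h2⟩ := (hpos.and h0).exists
  exact h1.ne' h2

theorem IsRandomCellProb.sum_mixedMoment_add_single [IsProbabilityMeasure P]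
    (hp : IsRandomCellProb P p) (n : (∀ v, I v) → ℕ) :
    ∑ i, mixedMoment P p (n + Pi.single i 1) = mixedMoment P p n := by
  unfold mixedMoment
  rw [← integral_finsetSum _ fun i _ => hp.integrable_monomial _]
  refine integral_congr_ae ?_
  filter_upwards [hp.sum_eq_one] with ω h1
  have h : ∀ i, ∏ x, p ω x ^ (n + Pi.single i 1 : (∀ v, I v) → ℕ) x =
      (∏ x, p ω x ^ n x) * p ω i := by
    intro i
    simp only [Pi.add_apply, pow_add, Finset.prod_mul_distrib]
    congr 1
    rw [Finset.prod_eq_single i] <;> simp +contextual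
  simp only [h, ← Finset.mul_sum, h1, mul_one]

theorem mixedMoment_zero {ι : Type*} [Fintype ι] [IsProbabilityMeasure P] (p : Ω → ι → ℝ) :
    mixedMoment P p 0 = 1 := by
  simp [mixedMoment]

theorem ParameterIndependence.mixedMoment_eq_prod {𝔭 : V → Finset V}
    (hp : IsRandomCellProb P p) {d : ℕ} {v : Fin d ≃ V} (hv : IsVertexNumbering 𝔭 v)
    (hind : ParameterIndependence P p 𝔭) (n : (∀ v, I v) → ℕ) :
    mixedMoment P p n = ∏ s, ∫ ω, ∏ m, dagParameter p 𝔭 s ω m ^ familyCount 𝔭 s n m ∂P := by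
  rw [← hind.indep.integral_fun_prod_comp
    (f := fun s θ => ∏ m, θ m ^ familyCount 𝔭 s n m)
    (fun s => (measurable_dagParameter hp.measurable 𝔭 s).aemeasurable)
    (fun s => Measurable.aestronglyMeasurable (by fun_prop))]
  refine integral_congr_ae ?_
  filter_upwards [hp.pos, hp.sum_eq_one] with ω h0 h1
  exact prod_pow_eq_prod_familyCount hv h0 h1 n

/-- Independence turns M(n) into a product over families. Since M(n) > 0, no factor vanishes and the
logarithm splits into a sum. -/
theorem ParameterIndependence.mixedDiffLocal_log [IsProbabilityMeasure P] {𝔭 : V → Finset V}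
    (hp : IsRandomCellProb P p) {d : ℕ} {v : Fin d ≃ V} (hv : IsVertexNumbering 𝔭 v)
    (hind : ParameterIndependence P p 𝔭) :
    MixedDiffLocal 𝔭 fun n => Real.log (mixedMoment P p n) := by
  refine mixedDiffLocal_of_eq_sum hv
    (fun s c => Real.log (∫ ω, ∏ m, dagParameter p 𝔭 s ω m ^ c m ∂P)) fun n => ?_
  have h := (hp.mixedMoment_pos n).ne'
  rw [hind.mixedMoment_eq_prod hp hv] at h ⊢
  exact Real.log_prod (Finset.prod_ne_zero_iff.mp h)

/-- If a vertex had only one value, its conditional probability would be identically 1,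
contradicting non-degeneracy. -/
theorem ParameterIndependence.nontrivial [Nonempty (∀ v, I v)] {𝔭 : V → Finset V}
    (hp : IsRandomCellProb P p) (hind : ParameterIndependence P p 𝔭) (v : V) :
    Nontrivial (I v) := by
  by_contra h
  rw [not_nontrivial_iff_subsingleton] at h
  obtain ⟨i⟩ := ‹Nonempty (∀ v, I v)›
  refine hind.nondegenerate ⟨v, (𝔭 v).restrict i⟩ ⟨fun _ => 1, ?_⟩
  filter_upwards [hp.pos] with ω h0
  ext m
  simp only [dagParameter, condCellProb]
  rw [div_eq_one_iff_eq (marginalProb_pos h0 _ i).ne', marginalProb]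
  exact Finset.sum_congr (Finset.filter_congr fun x _ => by
    simp [Subsingleton.elim (x v) m]) fun _ _ => rfl

/-- Otherwise every cell probability has variance zero, so p and with it every conditional
probability vector is almost surely constant. -/
theorem ParameterIndependence.exists_variance_pos [IsProbabilityMeasure P]
    [Nonempty (∀ v, I v)] [Nonempty V] {𝔭 : V → Finset V}
    (hp : IsRandomCellProb P p) (hind : ParameterIndependence P p 𝔭) :
    ∃ i, mixedMoment P p (Pi.single i 1) ^ 2 <
      mixedMoment P p (Pi.single i 1 + Pi.single i 1) * mixedMoment P p 0 := by
  by_contra! h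
  have e1 : ∀ i ω, ∏ x, p ω x ^ (Pi.single i 1 : (∀ v, I v) → ℕ) x = p ω i := by
    intro i ω
    rw [Finset.prod_eq_single i] <;> simp +contextual
  have e2 : ∀ i ω, ∏ x, p ω x ^ (Pi.single i 1 + Pi.single i 1 : (∀ v, I v) → ℕ) x =
      p ω i ^ 2 := by
    intro i ω
    simp only [Pi.add_apply, pow_add, Finset.prod_mul_distrib, e1]
    ring
  have i1 : ∀ i, Integrable (fun ω => p ω i) P := fun i =>
    (hp.integrable_monomial (Pi.single i 1)).congr (ae_of_all _ (e1 i))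
  have i2 : ∀ i, Integrable (fun ω => p ω i ^ 2) P := fun i =>
    (hp.integrable_monomial (Pi.single i 1 + Pi.single i 1)).congr (ae_of_all _ (e2 i))
  have hconst : ∀ i, ∀ᵐ ω ∂P, p ω i = ∫ ω, p ω i ∂P := by
    intro i
    have hi := h i
    rw [mixedMoment_zero, mul_one] at hi
    simp only [mixedMoment, e1, e2] at hi
    set c := ∫ ω, p ω i ∂P with hc
    have hsq : ∀ ω, (p ω i - c) ^ 2 = p ω i ^ 2 - 2 * c * p ω i + c ^ 2 := fun ω => by ring
    have hlin : Integrable (fun ω => p ω i ^ 2 - 2 * c * p ω i) P :=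
      (i2 i).sub ((i1 i).const_mul _)
    have hI : Integrable (fun ω => (p ω i - c) ^ 2) P := by
      simp only [hsq]
      exact hlin.add (integrable_const _)
    have hint : ∫ ω, (p ω i - c) ^ 2 ∂P = ∫ ω, p ω i ^ 2 ∂P - c ^ 2 := by
      simp only [hsq]
      rw [integral_add hlin (integrable_const _),
        integral_sub (i2 i) ((i1 i).const_mul _), integral_const_mul, ← hc]
      simp
      ring
    have h0 : ∫ ω, (p ω i - c) ^ 2 ∂P = 0 :=
      le_antisymm (by linarith) (integral_nonneg fun ω => sq_nonneg _)
    rw [integral_eq_zero_iff_of_nonneg (fun ω => sq_nonneg _) hI] at h0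
    filter_upwards [h0] with ω hω
    exact sub_eq_zero.mp (pow_eq_zero_iff two_ne_zero |>.mp hω)
  obtain ⟨i⟩ := ‹Nonempty (∀ v, I v)›
  obtain ⟨v⟩ := ‹Nonempty V›
  refine hind.nondegenerate ⟨v, (𝔭 v).restrict i⟩
    ⟨fun m => condCellProb (fun i => ∫ ω, p ω i ∂P) v (𝔭 v) ((𝔭 v).restrict i) m, ?_⟩
  filter_upwards [ae_all_iff.mpr hconst] with ω hω
  have : p ω = fun i => ∫ ω, p ω i ∂P := funext hω
  ext m
  simp only [dagParameter]
  rw [this]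

/-- A vector of random cell probabilities whose predictive probabilities have the Dirichlet form
is Dirichlet distributed. -/
theorem IsRandomCellProb.isClassicalDirichlet_of_predictive [IsProbabilityMeasure P]
    [Nonempty (∀ v, I v)] (hp : IsRandomCellProb P p) (α : (∀ v, I v) → ℝ) (hα : ∀ i, 0 < α i)
    (h : ∀ n i, mixedMoment P p (n + Pi.single i 1) * (∑ j, α j + ((∑ j, n j : ℕ) : ℝ)) =
      mixedMoment P p n * (α i + n i)) : IsClassicalDirichlet (P.map p) := by
  refine ⟨inferInstance, α, hα, fun i₀ => ?_⟩
  have := Measure.isProbabilityMeasure_map (μ := P) hp.measurable.aemeasurable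
  have hS : MeasurableSet {y : (∀ v, I v) → ℝ | ∀ i, y i ∈ Set.Icc (0 : ℝ) 1} := by
    rw [Set.ofPred_forall]
    exact MeasurableSet.iInter fun i => measurableSet_Icc.preimage (measurable_pi_apply i)
  refine ext_of_lintegral_moments _ _
    ((ae_map_iff hp.measurable.aemeasurable hS).mpr hp.ae_mem_Icc)
    (ae_mem_Icc_dirichletMeasure α i₀) fun n => ?_
  rw [lintegral_map (by fun_prop) hp.measurable,
    ← ofReal_integral_eq_lintegral_ofReal (hp.integrable_monomial n),
    lintegral_prod_pow_dirichletMeasure α hα]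
  · congr 1
    exact eq_gamma_of_predictive (mixedMoment P p) (mixedMoment_zero p) α hα h n
  · filter_upwards [hp.ae_mem_Icc] with ω hω
    exact Finset.prod_nonneg fun i _ => pow_nonneg (hω i).1 _

end Cells

theorem mainTheorem4 {V : Type*} [Fintype V] [DecidableEq V]
    {I : V → Type*} [∀ v, Fintype (I v)] [∀ v, DecidableEq (I v)]
    {d : ℕ} (hd : 2 ≤ d)
    {Ω : Type*} [MeasurableSpace Ω] (P : Measure Ω) [IsProbabilityMeasure P]
    (p : Ω → (∀ v, I v) → ℝ) (hp : IsRandomCellProb P p)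
    (𝔭 𝔭' : V → Finset V)
    (h𝔭 : IsMoralDAG (⊤ : SimpleGraph V) 𝔭) (h𝔭' : IsMoralDAG (⊤ : SimpleGraph V) 𝔭')
    (v v' : Fin d ≃ V) (hv : IsVertexNumbering 𝔭 v) (hv' : IsVertexNumbering 𝔭' v')
    (hne : ∀ j : Fin d, 1 ≤ j.val → 𝔭 (v j) ≠ 𝔭' (v' j))
    (hind : ParameterIndependence P p 𝔭) (hind' : ParameterIndependence P p 𝔭') :
    IsClassicalDirichlet (P.map p) := by
  -- With no cells the total probability would be an empty sum, not 1.
  have hcells : Nonempty (∀ v, I v) := by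
    obtain ⟨ω, hω⟩ := hp.sum_eq_one.exists
    by_contra hempty
    rw [not_nonempty_iff] at hempty
    simp at hω
  have hV : Nonempty V := ⟨v ⟨0, by omega⟩⟩
  have hI : ∀ v, Nontrivial (I v) := hind.nontrivial hp
  have hcells' : Nontrivial (∀ v, I v) := by
    obtain ⟨i⟩ := hcells
    obtain ⟨w⟩ := hV
    obtain ⟨m, hm⟩ := exists_ne (i w)
    exact ⟨Function.update i w m, i, fun h => hm (by simpa using congrFun h w)⟩
  obtain ⟨φ, hφ⟩ := exists_mixedDiff_eq hd hv hv' hne (hind.mixedDiffLocal_log hp hv)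
    (hind'.mixedDiffLocal_log hp hv')
  have hpos := hp.mixedMoment_pos
  obtain ⟨α, hα, h⟩ := predictive_of_mixed (mixedMoment P p) hpos hp.sum_mixedMoment_add_single
    (fun N => Real.exp (φ N)) (fun n i j hij => by
      rw [← hφ i j n hij, mixedDiff, ← Real.exp_log (hpos (n + Pi.single i 1 + Pi.single j 1)),
        ← Real.exp_log (hpos n), ← Real.exp_log (hpos (n + Pi.single i 1)),
        ← Real.exp_log (hpos (n + Pi.single j 1)), ← Real.exp_add, ← Real.exp_add, ← Real.exp_add]
      simp only [Real.log_exp]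
      ring_nf)
    (hind.exists_variance_pos hp)
  exact hp.isClassicalDirichlet_of_predictive α hα h
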